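/- Let $M_i^{n_i}$, $1\le i\le r$, be smooth Riemannian manifolds of dimensions $n_i\ge 2$ and let $f_i\colon M_i^{n_i}\to\mathbb{R}^{n_i+p_i}$ be smooth isometric immersions. Put $n=\sum_i n_i$, $p=\sum_i p_i$, let $M^n=M_1^{n_1}\times\cdots\times M_r^{n_r}$ be the Riemannian product, and let $f\colon M^n\to\mathbb{R}^{n+p}=\bigoplus_{i=1}^r\mathbb{R}^{n_i+p_i}$ be the extrinsic product of the $f_i$, that is, $f(x)=(f_1(x_1),\dots,f_r(x_r))$ for $x=(x_1,\dots,x_r)$. For an isometric immersion $h\colon N\to\mathbb{R}^m$ with normal spaces $N_hN(x)$ and second fundamental form $\alpha$, the $s$-nullity at $x\in N$, $1\le s\le m-\dim N$, is $$\nu_s(x)=\max\{\dim\mathcal N(\alpha_U)(x)\colon U\subset N_hN(x)\text{ a subspace},\ \dim U=s\},$$ where $\mathcal N(\alpha_U)(x)=\{Y\in T_xN\colon \pi_U\,\alpha(Y,X)=0\text{ for all }X\in T_xN\}$ and $\pi_U$ is the orthogonal projection onto $U$. An infinitesimal bending of $h$ is a smooth map $\mathcal T\colon N\to\mathbb{R}^m$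 (a section of $h^*T\mathbb{R}^m$) such that $\langle \mathcal T_*X,h_*Y\rangle+\langle h_*X,\mathcal T_*Y\rangle=0$ for all $X,Y\in T_xN$ and all $x\in N$; it is trivial if $\mathcal T=\mathcal D h+v$ with a skew-symmetric endomorphism $\mathcal D$ of $\mathbb{R}^m$ and $v\in\mathbb{R}^m$. Assume that $p<n$ and that the $s$-nullities of $f$ satisfy $\nu_s(x)<n-s$ for all $1\le s\le p$ and all $x\in M^n$. Then every infinitesimal bending $\mathcal T$ of $f$ is, locally and up to a trivial infinitesimal bending, a sum of infinitesimal bendings of the factors: for every $x^0\in M^n$ there are open neighborhoods $U_i\subset M_i$ of $x_i^0$, infinitesimal bendings $\mathcal T_i$ of $f_i|_{U_i}$, $1\le i\le r$, and a trivial infinitesimal bending $\mathcal S$ of $f$ such that $$\mathcal T(x)=\sum_{i=1}^r\tilde\iota_i\,\mathcal T_i(x_i)+\mathcal S(x)\qquad\text{for all }x\in U_1\times\cdots\times U_r,$$ where $\tilde\iota_i\colon\mathbb{R}^{n_i+p_i}\to\mathbb{R}^{n+p}$ is the inclusion of the $i$-th summand. -/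

import Mathlib

open scoped Manifold ContDiff

noncomputable section

namespace InfinitesimalBending

section Immersions

variable {E : Type*} [NormedAddCommGroup E] [NormedSpace ℝ E]
  {H : Type*} [TopologicalSpace H] (I : ModelWithCorners ℝ E H)
  {M : Type*} [TopologicalSpace M] [ChartedSpace H M]
  {V : Type*} [NormedAddCommGroup V] [InnerProductSpace ℝ V]

/-- The differential `f_* : T_x M → V` of a map into a Euclidean space, whose tangent spaces are
identified with `V`. -/
def differential (f : M → V) (x : M) : TangentSpace I x →L[ℝ] V :=
  mfderiv I 𝓘(ℝ, V) f x

/-- `f` is an isometric immersion of the Riemannian manifold `(M, g)` into the Euclidean space `V`: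
it is smooth and `⟨f_* X, f_* Y⟩ = g(X, Y)` for all tangent vectors `X, Y`.
(It is then an immersion, since `g` is positive definite.) -/
def IsIsometricImmersion [IsManifold I 1 M]
    (g : Bundle.ContMDiffRiemannianMetric I ∞ E (fun x : M => TangentSpace I x))
    (f : M → V) : Prop :=
  ContMDiff I 𝓘(ℝ, V) ∞ f ∧
    ∀ (x : M) (X Y : TangentSpace I x),
      inner ℝ (differential I f x X) (differential I f x Y) = g.inner x X Y

/-- `T`, a section over the open set `U` of the pull-back `f^* TV` (that is, a map into `V`), is an
infinitesimal bending of the restriction of `f` to `U`: it is smooth on `U` and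
`⟨T_* X, f_* Y⟩ + ⟨f_* X, T_* Y⟩ = 0` for all `X, Y` tangent to `M` at points of `U`.
The values of `T` outside `U` play no role. -/
def IsInfinitesimalBendingOn (f T : M → V) (U : Set M) : Prop :=
  ContMDiffOn I 𝓘(ℝ, V) ∞ T U ∧
    ∀ x ∈ U, ∀ X Y : TangentSpace I x,
      inner ℝ (differential I T x X) (differential I f x Y) +
        inner ℝ (differential I f x X) (differential I T x Y) = 0

/-- `T` is an infinitesimal bending of `f : M → V`. -/
def IsInfinitesimalBending (f T : M → V) : Prop :=
  IsInfinitesimalBendingOn I f T Set.univ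

/-- `T` is a trivial infinitesimal bending of `f`: the restriction to `f` of a Killing field of `V`,
that is, `T = D f + v` with a skew-symmetric endomorphism `D` and a vector `v`. -/
def IsTrivialBending (f T : M → V) : Prop :=
  ∃ (D : V →ₗ[ℝ] V) (v : V), (∀ a b : V, inner ℝ (D a) b = -inner ℝ a (D b)) ∧
    ∀ x, T x = D (f x) + v

/-- The normal space `N_f M(x)`, the orthogonal complement of `f_* T_x M` in `V`. -/
def normalSpace (f : M → V) (x : M) : Submodule ℝ V :=
  (differential I f x).rangeᗮ

/-- The second derivative at `x` of `f`, read in the preferred chart at `x`, as a bilinear map on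
`T_x M` (which the preferred chart identifies with the model space `E`). -/
def chartHessian (f : M → V) (x : M) : TangentSpace I x →ₗ[ℝ] TangentSpace I x →ₗ[ℝ] V :=
  (ContinuousLinearMap.toLinearMap₁₂
    (fderivWithin ℝ (fderivWithin ℝ (f ∘ (extChartAt I x).symm) (Set.range I)) (Set.range I)
      (extChartAt I x x)) : E →ₗ[ℝ] E →ₗ[ℝ] V)

variable [FiniteDimensional ℝ V]

/-- The second fundamental form `α(X, Y) = (∇̃_X f_* Y)_{N_f M}` of `f` at `x`.
Extend `Y` to the local field with constant components in the preferred chart `φ` at `x`. Then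
`f_* Y` reads `D(f ∘ φ⁻¹) Y` in this chart, so that `∇̃_X f_* Y` at `x` is the second derivative of
`f ∘ φ⁻¹` at `φ x` applied to `X` and `Y`. Another extension of `Y` changes `∇̃_X f_* Y` by a
tangent vector only, which the projection to the normal space removes. -/
def secondFundamentalForm (f : M → V) (x : M) :
    TangentSpace I x →ₗ[ℝ] TangentSpace I x →ₗ[ℝ] V :=
  (chartHessian I f x).compr₂ (normalSpace I f x).starProjection.toLinearMap

/-- The nullity space `𝒩(α_U)(x) = {Y ∈ T_x M : α_U(Y, X) = 0 for all X ∈ T_x M}`, where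
`α_U = π_U ∘ α` and `π_U` is the orthogonal projection onto `U`. -/
def nullitySpace (f : M → V) (x : M) (U : Submodule ℝ V) : Submodule ℝ (TangentSpace I x) where
  carrier := {Y | ∀ X : TangentSpace I x,
    U.starProjection (secondFundamentalForm I f x Y X) = 0}
  zero_mem' X := by simp
  add_mem' {Y Z} hY hZ X := by
    rw [map_add, LinearMap.add_apply, map_add, hY X, hZ X, add_zero]
  smul_mem' c Y hY X := by
    rw [map_smul, LinearMap.smul_apply, map_smul, hY X, smul_zero]

/-- The `s`-nullity `ν_s(x)` of `f`: the largest dimension of `𝒩(α_U)(x)`, where `U` runs over the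
`s`-dimensional subspaces of the normal space `N_f M(x)`. (For finite-dimensional `M` and
`s ≤ dim N_f M(x)` this is the maximum of a non-empty bounded set of natural numbers.) -/
def sNullity (f : M → V) (x : M) (s : ℕ) : ℕ :=
  sSup {d : ℕ | ∃ U : Submodule ℝ V, U ≤ normalSpace I f x ∧ Module.finrank ℝ U = s ∧
    d = Module.finrank ℝ (nullitySpace I f x U)}

end Immersions

/-- The extrinsic product `f(x) = (f₁(x₁), …, f_r(x_r))` of maps `f_i : M_i → V_i`, with values in
the orthogonal direct sum of the `V_i`. -/
def extrinsicProduct {ι : Type*} {M : ι → Type*} {V : ι → Type*}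
    (f : ∀ i, M i → V i) (x : ∀ i, M i) : PiLp 2 V :=
  WithLp.toLp 2 fun i => f i (x i)

end InfinitesimalBending

end

/-!
A bound on the `s`-nullities makes the second fundamental form `F''` of the extrinsic product `F`
nondegenerate in the sense of `NondegenerateAt`: if `B` violated this condition and had rank `s`,
then its kernel, of dimension `n - s`, would lie in the nullity space of its range.

Let `T` be a bending of `F` in a chart, let `Y` be tangent to some of the factors and let `π` be the
projection to the remaining ones. Since `F''(Y, π ·) = 0`, differentiating the bending equation
shows that the form `⟨F'(π X), T''(Y, π Z)⟩` is both skew-symmetric and symmetric in `X` and `Z`,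
hence zero. Differentiating once more, nondegeneracy gives `T''(Y, π Z) = 0`: the derivative of `T`
in the direction of a factor depends on the point of that factor only. Hence the bending equation
for vectors `X`, `Y` tangent to different factors holds even if they are based at different points.
Since the vectors `F' X` span the ambient space, one skew endomorphism `D` maps each of them to the
part of `T' X` outside the summand of the factor of `X`, and `T - D ∘ F` is a sum of bendings of
the factors.
-/

namespace InfinitesimalBending

section SkewExtension

variable {V : Type*} [NormedAddCommGroup V] [InnerProductSpace ℝ V] {α : Type*} {f t : α → V}

theorem inner_linearCombination_skew
    (h : ∀ a b, inner ℝ (t a) (f b) + inner ℝ (f a) (t b) = 0) (x y : α →₀ ℝ) :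
    inner ℝ (Finsupp.linearCombination ℝ t x) (Finsupp.linearCombination ℝ f y) =
      -inner ℝ (Finsupp.linearCombination ℝ f x) (Finsupp.linearCombination ℝ t y) := by
  simp only [Finsupp.linearCombination_apply, Finsupp.sum, sum_inner, inner_sum,
    real_inner_smul_left, real_inner_smul_right, eq_neg_of_add_eq_zero_left (h _ _), mul_neg,
    Finset.sum_neg_distrib]

theorem exists_skew_linearMap_of_span_eq_top (hf : Submodule.span ℝ (Set.range f) = ⊤)
    (h : ∀ a b, inner ℝ (t a) (f b) + inner ℝ (f a) (t b) = 0) :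
    ∃ D : V →ₗ[ℝ] V, (∀ a b, inner ℝ (D a) b = -inner ℝ a (D b)) ∧ ∀ a, D (f a) = t a := by
  obtain ⟨r, hr⟩ := (Finsupp.linearCombination ℝ f).exists_rightInverse_of_surjective
    (by rw [Finsupp.range_linearCombination, hf])
  have hr (v : V) : Finsupp.linearCombination ℝ f (r v) = v := LinearMap.congr_fun hr v
  refine ⟨Finsupp.linearCombination ℝ t ∘ₗ r, fun a b => ?_, fun a => ?_⟩
  · simpa only [LinearMap.comp_apply, hr] using inner_linearCombination_skew h (r a) (r b)
  · refine ext_inner_right ℝ fun v => ?_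
    have key := inner_linearCombination_skew h (r (f a)) (r v)
    have key' := inner_linearCombination_skew h (Finsupp.single a 1) (r v)
    simp only [hr, Finsupp.linearCombination_single, one_smul] at key key'
    exact key.trans key'.symm

end SkewExtension

section Calculus

variable {E : Type*} [NormedAddCommGroup E] [NormedSpace ℝ E]
  {V : Type*} [NormedAddCommGroup V] [NormedSpace ℝ V]

theorem eq_of_fderiv_sub_eq_zero {g : E → V} {W : Set E} (hW : Convex ℝ W)
    (hg : ∀ w ∈ W, DifferentiableAt ℝ g w) {y z : E} (hy : y ∈ W) (hz : z ∈ W)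
    (h : ∀ w ∈ W, fderiv ℝ g w (z - y) = 0) : g y = g z := by
  have hmem : ∀ t ∈ Set.Icc (0 : ℝ) 1, AffineMap.lineMap y z t ∈ W := fun t ht =>
    hW.segment_subset hy hz (segment_eq_image_lineMap ℝ y z ▸ Set.mem_image_of_mem _ ht)
  have hderiv : ∀ t ∈ Set.Icc (0 : ℝ) 1,
      HasDerivAt (fun t => g (AffineMap.lineMap y z t)) 0 t := fun t ht => by
    rw [← h _ (hmem t ht)]
    exact (hg _ (hmem t ht)).hasFDerivAt.comp_hasDerivAt t AffineMap.hasDerivAt_lineMap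
  have hconst := constant_of_has_deriv_right_zero
    (fun t ht => (hderiv t ht).continuousAt.continuousWithinAt)
    (fun t ht => (hderiv t (Set.Ico_subset_Icc_self ht)).hasDerivWithinAt) 1
    (Set.right_mem_Icc.2 zero_le_one)
  simpa using hconst.symm

theorem fderiv_apply_eq_of_eqOn {g k : E → V} {W : Set E} (hW : IsOpen W) (h : Set.EqOn g k W)
    {y : E} (hy : y ∈ W) (U : E) : fderiv ℝ g y U = fderiv ℝ k y U := by
  rw [(h.eventuallyEq_of_mem (hW.mem_nhds hy)).fderiv_eq]

theorem fderiv_fderiv_apply_const {G : E → V} {y : E} (hG : DifferentiableAt ℝ (fderiv ℝ G) y)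
    (X U : E) : fderiv ℝ (fun z => fderiv ℝ G z X) y U = fderiv ℝ (fderiv ℝ G) y U X := by
  simp [fderiv_clm_apply hG (differentiableAt_const X)]

end Calculus

section InnerCalculus

variable {E : Type*} [NormedAddCommGroup E] [NormedSpace ℝ E]
  {V : Type*} [NormedAddCommGroup V] [InnerProductSpace ℝ V]

theorem fderiv_inner_fderiv_apply {G S : E → V} {y : E}
    (hG : DifferentiableAt ℝ (fderiv ℝ G) y) (hS : DifferentiableAt ℝ (fderiv ℝ S) y)
    (X Z U : E) :
    fderiv ℝ (fun z => inner ℝ (fderiv ℝ G z X) (fderiv ℝ S z Z)) y U =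
      inner ℝ (fderiv ℝ (fderiv ℝ G) y U X) (fderiv ℝ S y Z) +
        inner ℝ (fderiv ℝ G y X) (fderiv ℝ (fderiv ℝ S) y U Z) := by
  rw [fderiv_inner_apply ℝ (hG.clm_apply (differentiableAt_const X))
    (hS.clm_apply (differentiableAt_const Z)), fderiv_fderiv_apply_const hG,
    fderiv_fderiv_apply_const hS, add_comm]

end InnerCalculus

section Bending

variable {E : Type*} [NormedAddCommGroup E] [NormedSpace ℝ E]
  {V : Type*} [NormedAddCommGroup V] [InnerProductSpace ℝ V] {F T : E → V} {W : Set E} {y : E}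

theorem isInfinitesimalBendingOn_iff_fderiv :
    IsInfinitesimalBendingOn 𝓘(ℝ, E) F T W ↔ ContDiffOn ℝ ∞ T W ∧ ∀ y ∈ W, ∀ X Y : E,
      inner ℝ (fderiv ℝ T y X) (fderiv ℝ F y Y) +
        inner ℝ (fderiv ℝ F y X) (fderiv ℝ T y Y) = 0 := by
  simp only [IsInfinitesimalBendingOn, differential, mfderiv_eq_fderiv, contMDiffOn_iff_contDiffOn]
  rfl

theorem differentiableAt_fderiv_of_contDiffOn (hW : IsOpen W) (hF : ContDiffOn ℝ ∞ F W)
    (hy : y ∈ W) : DifferentiableAt ℝ (fderiv ℝ F) y :=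
  ((hF.contDiffAt (hW.mem_nhds hy)).fderiv_right (m := ∞) (by simp)).differentiableAt
    (by simp)

theorem fderiv_fderiv_comm_of_contDiffOn (hW : IsOpen W) (hF : ContDiffOn ℝ ∞ F W) (hy : y ∈ W)
    (X Y : E) : fderiv ℝ (fderiv ℝ F) y X Y = fderiv ℝ (fderiv ℝ F) y Y X :=
  (hF.contDiffAt (hW.mem_nhds hy)).isSymmSndFDerivAt
    (by simpa using WithTop.coe_le_coe.2 (le_top : (2 : ℕ∞) ≤ ⊤)) X Y

theorem contDiffOn_fderiv_apply_const (hW : IsOpen W) (hF : ContDiffOn ℝ ∞ F W) (X : E) :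
    ContDiffOn ℝ ∞ (fun z => fderiv ℝ F z X) W :=
  (hF.fderiv_of_isOpen hW (by simp)).clm_apply contDiffOn_const

theorem IsInfinitesimalBendingOn.fderiv_fderiv (hT : IsInfinitesimalBendingOn 𝓘(ℝ, E) F T W)
    (hW : IsOpen W) (hF : ContDiffOn ℝ ∞ F W) (hy : y ∈ W) (U X Z : E) :
    inner ℝ (fderiv ℝ (fderiv ℝ T) y U X) (fderiv ℝ F y Z) +
        inner ℝ (fderiv ℝ T y X) (fderiv ℝ (fderiv ℝ F) y U Z) +
      (inner ℝ (fderiv ℝ (fderiv ℝ F) y U X) (fderiv ℝ T y Z) +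
        inner ℝ (fderiv ℝ F y X) (fderiv ℝ (fderiv ℝ T) y U Z)) = 0 := by
  rw [isInfinitesimalBendingOn_iff_fderiv] at hT
  have hF' := differentiableAt_fderiv_of_contDiffOn hW hF hy
  have hT' := differentiableAt_fderiv_of_contDiffOn hW hT.1 hy
  have hderiv := fderiv_apply_eq_of_eqOn hW (fun z hz => hT.2 z hz X Z) hy U
  rw [fderiv_fun_add
    ((hT'.clm_apply (differentiableAt_const X)).inner ℝ (hF'.clm_apply (differentiableAt_const Z)))
    ((hF'.clm_apply (differentiableAt_const X)).inner ℝ (hT'.clm_apply (differentiableAt_const Z)))]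
    at hderiv
  simpa [fderiv_inner_fderiv_apply hT' hF', fderiv_inner_fderiv_apply hF' hT'] using hderiv

theorem IsInfinitesimalBendingOn.differentiableAt (hT : IsInfinitesimalBendingOn 𝓘(ℝ, E) F T W)
    (hW : IsOpen W) (hy : y ∈ W) : DifferentiableAt ℝ T y :=
  (hT.1.contDiffOn.contDiffAt (hW.mem_nhds hy)).differentiableAt (by simp)

theorem IsInfinitesimalBendingOn.hasFDerivAt_sub_comp
    (hT : IsInfinitesimalBendingOn 𝓘(ℝ, E) F T W) (hW : IsOpen W) (hF : ContDiffOn ℝ ∞ F W)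
    (D : V →L[ℝ] V) (hy : y ∈ W) :
    HasFDerivAt (fun z => T z - D (F z)) (fderiv ℝ T y - D ∘L fderiv ℝ F y) y :=
  (hT.differentiableAt hW hy).hasFDerivAt.sub <| D.hasFDerivAt.comp y
    ((hF.contDiffAt (hW.mem_nhds hy)).differentiableAt (by simp)).hasFDerivAt

theorem IsInfinitesimalBendingOn.sub_skew
    (hT : IsInfinitesimalBendingOn 𝓘(ℝ, E) F T W) (hW : IsOpen W) (hF : ContDiffOn ℝ ∞ F W)
    {D : V →L[ℝ] V} (hD : ∀ a b, inner ℝ (D a) b = -inner ℝ a (D b)) :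
    IsInfinitesimalBendingOn 𝓘(ℝ, E) F (fun z => T z - D (F z)) W := by
  refine isInfinitesimalBendingOn_iff_fderiv.2
    ⟨hT.1.contDiffOn.sub (D.contDiff.comp_contDiffOn hF), fun y hy X Y => ?_⟩
  rw [(hT.hasFDerivAt_sub_comp hW hF D hy).fderiv]
  simp only [sub_apply, ContinuousLinearMap.comp_apply, inner_sub_left, inner_sub_right, hD]
  linarith [(isInfinitesimalBendingOn_iff_fderiv.1 hT).2 y hy X Y]

end Bending

section Nondegeneracy

variable {E : Type*} [NormedAddCommGroup E] [NormedSpace ℝ E]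
  {V : Type*} [NormedAddCommGroup V] [InnerProductSpace ℝ V] {F : E → V} {W : Set E} {y : E}

/-- Nondegeneracy of the second fundamental form of `F` at `y`: a linear map `B` with values in the
normal space at `y` vanishes if `⟨F''(U, X), B Z⟩` is symmetric in `U` and `Z`. Since `B` is
normal-valued, `F''` need not be projected to the normal space. -/
def NondegenerateAt (F : E → V) (y : E) : Prop :=
  ∀ B : E →ₗ[ℝ] V, (∀ X Z, inner ℝ (fderiv ℝ F y X) (B Z) = 0) →
    (∀ U X Z, inner ℝ (fderiv ℝ (fderiv ℝ F) y U X) (B Z) =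
      inner ℝ (fderiv ℝ (fderiv ℝ F) y Z X) (B U)) → B = 0

theorem NondegenerateAt.eq_zero_of_inner_fderiv_eq_zero [Nontrivial E]
    (hnd : NondegenerateAt F y) (hW : IsOpen W) (hF : ContDiffOn ℝ ∞ F W) (hy : y ∈ W) {c : V}
    (hc : ∀ z ∈ W, ∀ X, inner ℝ (fderiv ℝ F z X) c = 0) : c = 0 := by
  obtain ⟨e, he⟩ := exists_ne (0 : E)
  obtain ⟨l, hl⟩ := SeparatingDual.exists_ne_zero (R := ℝ) he
  have hc' (U X : E) : inner ℝ (fderiv ℝ (fderiv ℝ F) y U X) c = 0 := by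
    have hF' := differentiableAt_fderiv_of_contDiffOn hW hF hy
    have hderiv := fderiv_apply_eq_of_eqOn hW (fun z hz => hc z hz X) hy U
    rw [fderiv_inner_apply ℝ (by fun_prop) (by fun_prop)] at hderiv
    simpa [fderiv_fderiv_apply_const hF'] using hderiv
  have hB := hnd ((l : E →ₗ[ℝ] ℝ).smulRight c)
    (fun X Z => by simp [real_inner_smul_right, hc y hy])
    (fun U X Z => by simp [real_inner_smul_right, hc'])
  simpa [hl] using LinearMap.congr_fun hB e

end Nondegeneracy

section Splitting

variable {E : Type*} [NormedAddCommGroup E] [NormedSpace ℝ E]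
  {V : Type*} [NormedAddCommGroup V] [InnerProductSpace ℝ V] {F T : E → V} {W : Set E} {y : E}

/-- Over `W`, the map `F` splits as an extrinsic product of two factors: `π` projects the source to
the directions of one of them and `Q` projects `V` orthogonally to its summand. Encoding the
splitting by projections instead of coordinates makes the factors interchangeable, through
`(1 - π, 1 - Q)`. -/
structure IsExtrinsicSplittingOn (F : E → V) (W : Set E) (π : E →ₗ[ℝ] E) (Q : V →L[ℝ] V) :
    Prop where
  idempotent : IsIdempotentElem π
  symmetric : ∀ u v, inner ℝ (Q u) v = inner ℝ u (Q v)
  apply_fderiv : ∀ y ∈ W, ∀ X, Q (fderiv ℝ F y X) = fderiv ℝ F y (π X)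

namespace IsExtrinsicSplittingOn

variable {π : E →ₗ[ℝ] E} {Q : V →L[ℝ] V}

theorem one_sub (h : IsExtrinsicSplittingOn F W π Q) :
    IsExtrinsicSplittingOn F W (1 - π) (1 - Q) where
  idempotent := h.idempotent.one_sub
  symmetric u v := by simp [inner_sub_left, inner_sub_right, h.symmetric]
  apply_fderiv y hy X := by simp [h.apply_fderiv y hy]

theorem apply_apply (h : IsExtrinsicSplittingOn F W π Q) (X : E) : π (π X) = π X :=
  LinearMap.congr_fun h.idempotent X

variable (h : IsExtrinsicSplittingOn F W π Q) (hW : IsOpen W) (hF : ContDiffOn ℝ ∞ F W)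

include h hW hF

theorem apply_fderiv_fderiv (hy : y ∈ W) (U X : E) :
    Q (fderiv ℝ (fderiv ℝ F) y U X) = fderiv ℝ (fderiv ℝ F) y U (π X) := by
  have hF' := differentiableAt_fderiv_of_contDiffOn hW hF hy
  have hderiv := fderiv_apply_eq_of_eqOn hW (fun z hz => h.apply_fderiv z hz X) hy U
  have hQ : HasFDerivAt (fun z => Q (fderiv ℝ F z X)) _ y :=
    Q.hasFDerivAt.comp y (hF'.clm_apply (differentiableAt_const X)).hasFDerivAt
  rw [hQ.fderiv, ContinuousLinearMap.comp_apply] at hderiv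
  simpa only [fderiv_fderiv_apply_const hF'] using hderiv

theorem fderiv_fderiv_apply_left (hy : y ∈ W) (U X : E) :
    fderiv ℝ (fderiv ℝ F) y (π U) X = fderiv ℝ (fderiv ℝ F) y U (π X) := by
  rw [fderiv_fderiv_comm_of_contDiffOn hW hF hy, ← h.apply_fderiv_fderiv hW hF hy,
    fderiv_fderiv_comm_of_contDiffOn hW hF hy, h.apply_fderiv_fderiv hW hF hy]

variable (hT : IsInfinitesimalBendingOn 𝓘(ℝ, E) F T W) {Y : E} (hY : π Y = 0)

include hT hY

theorem inner_fderiv_fderiv_fderiv_eq_zero (hy : y ∈ W) (X Z : E) :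
    inner ℝ (fderiv ℝ F y (π X)) (fderiv ℝ (fderiv ℝ T) y Y (π Z)) = 0 := by
  have hFcomm := fderiv_fderiv_comm_of_contDiffOn hW hF hy
  have hTcomm := fderiv_fderiv_comm_of_contDiffOn hW hT.1.contDiffOn hy
  have hFY (X : E) : fderiv ℝ (fderiv ℝ F) y Y (π X) = 0 := by
    rw [← h.fderiv_fderiv_apply_left hW hF hy, hY, map_zero, zero_apply]
  -- In `X` and `Z` the form is skew by `hskew`, and symmetric by `hsymm` and `hsymm'`.
  have hskew := hT.fderiv_fderiv hW hF hy Y (π X) (π Z)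
  have hsymm := hT.fderiv_fderiv hW hF hy (π X) (π Z) Y
  have hsymm' := hT.fderiv_fderiv hW hF hy (π Z) (π X) Y
  rw [hFcomm _ Y, hTcomm _ Y] at hsymm hsymm'
  rw [hTcomm (π X), hFcomm (π X)] at hsymm
  simp only [hFY, inner_zero_left, inner_zero_right, add_zero, zero_add] at hskew hsymm hsymm'
  rw [real_inner_comm] at hskew
  linarith

theorem apply_fderiv_fderiv_bending_eq_zero (hy : y ∈ W) (hnd : NondegenerateAt F y) (Z : E) :
    Q (fderiv ℝ (fderiv ℝ T) y Y (π Z)) = 0 := by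
  have hTW : ContDiffOn ℝ ∞ T W := hT.1.contDiffOn
  set S := fun z => fderiv ℝ T z Y with hS
  have hSW : ContDiffOn ℝ ∞ S W := contDiffOn_fderiv_apply_const hW hTW Y
  have hSderiv : ∀ z ∈ W, ∀ Z, fderiv ℝ S z Z = fderiv ℝ (fderiv ℝ T) z Y Z := fun z hz Z => by
    rw [hS, fderiv_fderiv_apply_const (differentiableAt_fderiv_of_contDiffOn hW hTW hz),
      fderiv_fderiv_comm_of_contDiffOn hW hTW hz]
  have hprolong (U X Z : E) :
      inner ℝ (fderiv ℝ (fderiv ℝ F) y U (π X)) (fderiv ℝ S y (π Z)) =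
        -inner ℝ (fderiv ℝ F y (π X)) (fderiv ℝ (fderiv ℝ S) y (π U) (π Z)) := by
    have hzero : ∀ z ∈ W, inner ℝ (fderiv ℝ F z (π X)) (fderiv ℝ S z (π Z)) = 0 := fun z hz => by
      rw [hSderiv z hz, h.inner_fderiv_fderiv_fderiv_eq_zero hW hF hT hY hz]
    have hderiv := fderiv_apply_eq_of_eqOn hW hzero hy (π U)
    simp only [fderiv_fun_const, Pi.zero_apply, zero_apply, fderiv_inner_fderiv_apply
      (differentiableAt_fderiv_of_contDiffOn hW hF hy)
      (differentiableAt_fderiv_of_contDiffOn hW hSW hy)] at hderiv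
    rw [h.fderiv_fderiv_apply_left hW hF hy, h.apply_apply] at hderiv
    exact eq_neg_of_add_eq_zero_left hderiv
  have hB := hnd ((Q : V →ₗ[ℝ] V) ∘ₗ (fderiv ℝ S y : E →ₗ[ℝ] V) ∘ₗ π)
    (fun X Z => by
      simp [← h.symmetric, h.apply_fderiv y hy, hSderiv y hy,
        h.inner_fderiv_fderiv_fderiv_eq_zero hW hF hT hY hy])
    (fun U X Z => by
      simp [← h.symmetric, h.apply_fderiv_fderiv hW hF hy, hprolong,
        fderiv_fderiv_comm_of_contDiffOn hW hSW hy (π U)])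
  rw [← hSderiv y hy]
  exact LinearMap.congr_fun hB Z

theorem fderiv_fderiv_bending_eq_zero (hy : y ∈ W) (hnd : NondegenerateAt F y) {Z : E}
    (hZ : π Z = Z) : fderiv ℝ (fderiv ℝ T) y Y Z = 0 := by
  have hQ := h.apply_fderiv_fderiv_bending_eq_zero hW hF hT hY hy hnd Z
  have hQ' := h.one_sub.apply_fderiv_fderiv_bending_eq_zero hW hF hT
    (Y := Z) (by simp [hZ]) hy hnd Y
  simp only [LinearMap.sub_apply, Module.End.one_apply, hY, sub_zero,
    sub_apply, one_apply_eq_self, sub_eq_zero] at hQ'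
  rw [hZ] at hQ
  rw [fderiv_fderiv_comm_of_contDiffOn hW hT.1.contDiffOn hy] at hQ ⊢
  exact hQ'.trans hQ

omit hY in
theorem fderiv_bending_eq (hWc : Convex ℝ W) (hnd : ∀ w ∈ W, NondegenerateAt F w) {z : E}
    (hy : y ∈ W) (hz : z ∈ W) (hyz : π (z - y) = 0) {Z : E} (hZ : π Z = Z) :
    fderiv ℝ T y Z = fderiv ℝ T z Z := by
  have hT' : ∀ w ∈ W, DifferentiableAt ℝ (fderiv ℝ T) w := fun w hw =>
    differentiableAt_fderiv_of_contDiffOn hW hT.1.contDiffOn hw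
  refine eq_of_fderiv_sub_eq_zero (g := fun w => fderiv ℝ T w Z) hWc
    (fun w hw => (hT' w hw).clm_apply (differentiableAt_const Z)) hy hz fun w hw => ?_
  rw [fderiv_fderiv_apply_const (hT' w hw)]
  exact h.fderiv_fderiv_bending_eq_zero hW hF hT hyz hw (hnd w hw) hZ

end IsExtrinsicSplittingOn

end Splitting

section Reparametrization

variable {E : Type*} [NormedAddCommGroup E] [NormedSpace ℝ E]
  {E' : Type*} [NormedAddCommGroup E'] [NormedSpace ℝ E']
  {V : Type*} [NormedAddCommGroup V] {F : E → V} {G : E' → V} {ψ : E' → E} {c : E'}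

section Derivatives

variable [NormedSpace ℝ V]

theorem eventuallyEq_fderiv_comp (hF : ContDiffAt ℝ 1 F (ψ c)) (hψ : ContDiffAt ℝ 1 ψ c)
    (hG : G =ᶠ[nhds c] F ∘ ψ) :
    fderiv ℝ G =ᶠ[nhds c] fun z => fderiv ℝ F (ψ z) ∘L fderiv ℝ ψ z := by
  filter_upwards [hG.eventuallyEq_nhds, hψ.eventually (by simp),
    hψ.continuousAt.eventually (hF.eventually (by simp))] with z hGz hψz hFz
  rw [hGz.fderiv_eq]
  exact fderiv_comp z (hFz.differentiableAt (by simp)) (hψz.differentiableAt (by simp))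

theorem fderiv_fderiv_comp_apply (hF : ContDiffAt ℝ 2 F (ψ c)) (hψ : ContDiffAt ℝ 2 ψ c)
    (hG : G =ᶠ[nhds c] F ∘ ψ) (X Y : E') :
    fderiv ℝ (fderiv ℝ G) c X Y = fderiv ℝ F (ψ c) (fderiv ℝ (fderiv ℝ ψ) c X Y) +
      fderiv ℝ (fderiv ℝ F) (ψ c) (fderiv ℝ ψ c X) (fderiv ℝ ψ c Y) := by
  have hF' := (hF.fderiv_right (m := 1) one_add_one_eq_two.le).differentiableAt (by simp)
  have hψ' := (hψ.fderiv_right (m := 1) one_add_one_eq_two.le).differentiableAt (by simp)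
  have hFψ : HasFDerivAt (fun z => fderiv ℝ F (ψ z)) _ c :=
    hF'.hasFDerivAt.comp c (hψ.differentiableAt (by simp)).hasFDerivAt
  rw [(eventuallyEq_fderiv_comp (hF.of_le one_le_two) (hψ.of_le one_le_two) hG).fderiv_eq,
    (hFψ.clm_comp hψ'.hasFDerivAt).fderiv]
  simp

end Derivatives

variable [InnerProductSpace ℝ V]

theorem NondegenerateAt.of_comp (h : NondegenerateAt G c) (hF : ContDiffAt ℝ 2 F (ψ c))
    (hψ : ContDiffAt ℝ 2 ψ c) (hG : G =ᶠ[nhds c] F ∘ ψ)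
    (hsurj : Function.Surjective (fderiv ℝ ψ c)) : NondegenerateAt F (ψ c) := by
  intro B hB hB'
  have hG' : fderiv ℝ G c = fderiv ℝ F (ψ c) ∘L fderiv ℝ ψ c :=
    (eventuallyEq_fderiv_comp (hF.of_le one_le_two) (hψ.of_le one_le_two) hG).eq_of_nhds
  have hBψ := h (B ∘ₗ (fderiv ℝ ψ c : E' →ₗ[ℝ] E)) (fun X Z => by simp [hG', hB])
    (fun U X Z => by
      simp [fderiv_fderiv_comp_apply hF hψ hG, inner_add_left, hB, hB' (fderiv ℝ ψ c U)])
  ext X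
  obtain ⟨Y, rfl⟩ := hsurj X
  exact LinearMap.congr_fun hBψ Y

end Reparametrization

section ProductCalculus

variable {ι : Type*} [Finite ι]
  {E : ι → Type*} [∀ i, NormedAddCommGroup (E i)] [∀ i, NormedSpace ℝ (E i)]
  {V : ι → Type*} [∀ i, NormedAddCommGroup (V i)] [∀ i, InnerProductSpace ℝ (V i)]
  {F : ∀ i, E i → V i} {y : ∀ i, E i}

theorem hasFDerivAt_extrinsicProduct (hF : ∀ i, DifferentiableAt ℝ (F i) (y i)) :
    HasFDerivAt (extrinsicProduct F)
      ((PiLp.continuousLinearEquiv 2 ℝ V).symm.toContinuousLinearMap ∘L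
        ContinuousLinearMap.pi fun i => fderiv ℝ (F i) (y i) ∘L ContinuousLinearMap.proj i) y := by
  cases nonempty_fintype ι
  exact (PiLp.continuousLinearEquiv 2 ℝ V).symm.hasFDerivAt.comp y <|
    hasFDerivAt_pi.2 fun i => (hF i).hasFDerivAt.comp y (hasFDerivAt_apply i y)

theorem fderiv_extrinsicProduct_single [DecidableEq ι]
    (hF : ∀ i, DifferentiableAt ℝ (F i) (y i)) (i : ι) (X : E i) :
    fderiv ℝ (extrinsicProduct F) y (Pi.single i X) =
      PiLp.single 2 i (fderiv ℝ (F i) (y i) X) := by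
  cases nonempty_fintype ι
  rw [(hasFDerivAt_extrinsicProduct hF).fderiv]
  refine PiLp.ext fun j => ?_
  obtain rfl | hj := eq_or_ne j i <;> simp [*]

theorem hasFDerivAt_piLp_apply {E' : Type*} [NormedAddCommGroup E'] [NormedSpace ℝ E']
    {R : E' → PiLp 2 V} {y : E'} (hR : DifferentiableAt ℝ R y) (i : ι) :
    HasFDerivAt (fun z => R z i) (PiLp.proj 2 V i ∘L fderiv ℝ R y) y := by
  cases nonempty_fintype ι
  exact (PiLp.proj (𝕜 := ℝ) 2 V i).hasFDerivAt.comp y hR.hasFDerivAt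

theorem hasFDerivAt_apply_update [DecidableEq ι] {R : (∀ i, E i) → PiLp 2 V} {o : ∀ i, E i}
    {i : ι} {z : E i} (hR : DifferentiableAt ℝ R (Function.update o i z)) :
    HasFDerivAt (fun z => R (Function.update o i z) i)
      ((PiLp.proj 2 V i ∘L fderiv ℝ R (Function.update o i z)) ∘L
        ContinuousLinearMap.single ℝ E i) z := by
  cases nonempty_fintype ι
  exact (hasFDerivAt_piLp_apply hR i).comp z <|
    (hasFDerivAt_update o z).congr_fderiv <| by
      ext X j
      obtain rfl | hj := eq_or_ne j i <;> simp [*]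

end ProductCalculus

section Box

variable {ι : Type*} [Fintype ι] [DecidableEq ι]
  {E : ι → Type*} [∀ i, NormedAddCommGroup (E i)] [∀ i, NormedSpace ℝ (E i)]
  {V : ι → Type*} [∀ i, NormedAddCommGroup (V i)] [∀ i, InnerProductSpace ℝ (V i)]
  {F : ∀ i, E i → V i} {T : (∀ i, E i) → PiLp 2 V} {W : ∀ i, Set (E i)}

theorem inner_piLp_single_right (a : PiLp 2 V) (i : ι) (v : V i) :
    inner ℝ a (PiLp.single 2 i v) = inner ℝ (a i) v := by
  rw [PiLp.inner_apply, Finset.sum_eq_single i (fun j _ hj => by simp [hj]) (by simp),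
    PiLp.single_eq_same]

theorem inner_piLp_single_left (a : PiLp 2 V) (i : ι) (v : V i) :
    inner ℝ (PiLp.single 2 i v) a = inner ℝ v (a i) := by
  rw [real_inner_comm, inner_piLp_single_right, real_inner_comm]

omit [DecidableEq ι] in
theorem contDiffOn_extrinsicProduct (hF : ∀ i, ContDiffOn ℝ ∞ (F i) (W i)) :
    ContDiffOn ℝ ∞ (extrinsicProduct F) (Set.univ.pi W) :=
  (contDiffOn_piLp 2).2 fun i => (hF i).comp (contDiff_pi.1 contDiff_id i).contDiffOn
    fun _ hy => hy i trivial

omit [Fintype ι] [DecidableEq ι] in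
theorem differentiableAt_of_mem_pi (hW : ∀ i, IsOpen (W i)) (hF : ∀ i, ContDiffOn ℝ ∞ (F i) (W i))
    {y : ∀ i, E i} (hy : y ∈ Set.univ.pi W) (i : ι) : DifferentiableAt ℝ (F i) (y i) :=
  ((hF i).contDiffAt ((hW i).mem_nhds (hy i trivial))).differentiableAt (by simp)

theorem isExtrinsicSplittingOn_extrinsicProduct (hW : ∀ i, IsOpen (W i))
    (hF : ∀ i, ContDiffOn ℝ ∞ (F i) (W i)) (i : ι) :
    IsExtrinsicSplittingOn (extrinsicProduct F) (Set.univ.pi W)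
      (LinearMap.single ℝ E i ∘ₗ LinearMap.proj i)
      ((PiLp.continuousLinearEquiv 2 ℝ V).symm.toContinuousLinearMap ∘L
        ContinuousLinearMap.single ℝ V i ∘L PiLp.proj 2 V i) where
  idempotent := LinearMap.ext fun X => by simp
  symmetric u v :=
    (inner_piLp_single_left v i (u i)).trans (inner_piLp_single_right u i (v i)).symm
  apply_fderiv y hy X := by
    have hFy := differentiableAt_of_mem_pi hW hF hy
    change PiLp.single 2 i _ = fderiv ℝ (extrinsicProduct F) y (Pi.single i (X i))
    rw [fderiv_extrinsicProduct_single hFy, (hasFDerivAt_extrinsicProduct hFy).fderiv]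
    rfl

theorem span_fderiv_single_eq_top [∀ i, FiniteDimensional ℝ (V i)] [Nontrivial (∀ i, E i)]
    (hW : ∀ i, IsOpen (W i)) (hF : ∀ i, ContDiffOn ℝ ∞ (F i) (W i)) {o : ∀ i, E i}
    (ho : o ∈ Set.univ.pi W) (hnd : NondegenerateAt (extrinsicProduct F) o) :
    Submodule.span ℝ (Set.range fun a : (Σ i, E i) × Set.univ.pi W =>
      fderiv ℝ (extrinsicProduct F) a.2 (Pi.single a.1.1 a.1.2)) = ⊤ := by
  rw [← Submodule.orthogonal_eq_bot_iff, Submodule.eq_bot_iff]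
  intro c hc
  refine hnd.eq_zero_of_inner_fderiv_eq_zero (isOpen_set_pi Set.finite_univ fun i _ => hW i)
    (contDiffOn_extrinsicProduct hF) ho fun y hy X => hc _ ?_
  rw [← Finset.univ_sum_single X, map_sum]
  exact Submodule.sum_mem _ fun i _ => Submodule.subset_span ⟨⟨⟨i, X i⟩, ⟨y, hy⟩⟩, rfl⟩

section

variable (hWo : ∀ i, IsOpen (W i)) (hWc : ∀ i, Convex ℝ (W i))
  (hF : ∀ i, ContDiffOn ℝ ∞ (F i) (W i))
  (hnd : ∀ y ∈ Set.univ.pi W, NondegenerateAt (extrinsicProduct F) y)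
  (hT : IsInfinitesimalBendingOn 𝓘(ℝ, ∀ i, E i) (extrinsicProduct F) T (Set.univ.pi W))

include hWo hWc hF hnd hT

theorem fderiv_bending_single_eq {y z : ∀ i, E i} (hy : y ∈ Set.univ.pi W)
    (hz : z ∈ Set.univ.pi W) {i : ι} (hyz : y i = z i) (X : E i) :
    fderiv ℝ T y (Pi.single i X) = fderiv ℝ T z (Pi.single i X) :=
  (isExtrinsicSplittingOn_extrinsicProduct hWo hF i).fderiv_bending_eq
    (isOpen_set_pi Set.finite_univ fun i _ => hWo i) (contDiffOn_extrinsicProduct hF) hT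
    (convex_pi fun i _ => hWc i) hnd hy hz (by simp [hyz]) (by simp)

theorem inner_fderiv_bending_single_skew {i j : ι} (hij : i ≠ j) {y z : ∀ i, E i}
    (hy : y ∈ Set.univ.pi W) (hz : z ∈ Set.univ.pi W) (X : E i) (Y : E j) :
    inner ℝ (fderiv ℝ T y (Pi.single i X)) (fderiv ℝ (extrinsicProduct F) z (Pi.single j Y)) +
      inner ℝ (fderiv ℝ (extrinsicProduct F) y (Pi.single i X))
        (fderiv ℝ T z (Pi.single j Y)) = 0 := by
  set w := Function.update z i (y i) with hw
  have hwW : w ∈ Set.univ.pi W := (Set.update_mem_pi_iff_of_mem hz).2 fun _ => hy i trivial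
  have hwi : y i = w i := by simp [hw]
  have hwj : z j = w j := by simp [hw, hij.symm]
  have hFsingle : ∀ y ∈ Set.univ.pi W, ∀ i X, fderiv ℝ (extrinsicProduct F) y (Pi.single i X) =
      PiLp.single 2 i (fderiv ℝ (F i) (y i) X) := fun y hy i X =>
    fderiv_extrinsicProduct_single (differentiableAt_of_mem_pi hWo hF hy) i X
  have hbend := (isInfinitesimalBendingOn_iff_fderiv.1 hT).2 w hwW (Pi.single i X) (Pi.single j Y)
  rw [fderiv_bending_single_eq hWo hWc hF hnd hT hy hwW hwi,
    fderiv_bending_single_eq hWo hWc hF hnd hT hz hwW hwj, hFsingle y hy, hFsingle z hz, hwi, hwj,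
    ← hFsingle w hwW, ← hFsingle w hwW, hbend]

theorem exists_skew_apply_fderiv_single [∀ i, FiniteDimensional ℝ (V i)] [Nontrivial (∀ i, E i)]
    {o : ∀ i, E i} (ho : o ∈ Set.univ.pi W) :
    ∃ D : PiLp 2 V →ₗ[ℝ] PiLp 2 V, (∀ a b, inner ℝ (D a) b = -inner ℝ a (D b)) ∧
      ∀ y ∈ Set.univ.pi W, ∀ i X, D (fderiv ℝ (extrinsicProduct F) y (Pi.single i X)) =
        fderiv ℝ T y (Pi.single i X) - PiLp.single 2 i (fderiv ℝ T y (Pi.single i X) i) := by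
  let P (a : (Σ i, E i) × Set.univ.pi W) : PiLp 2 V :=
    fderiv ℝ (extrinsicProduct F) a.2 (Pi.single a.1.1 a.1.2)
  let t (a : (Σ i, E i) × Set.univ.pi W) : PiLp 2 V := fderiv ℝ T a.2 (Pi.single a.1.1 a.1.2) -
    PiLp.single 2 a.1.1 (fderiv ℝ T a.2 (Pi.single a.1.1 a.1.2) a.1.1)
  have hskew : ∀ a b, inner ℝ (t a) (P b) + inner ℝ (P a) (t b) = 0 := by
    rintro ⟨⟨i, X⟩, y, hy⟩ ⟨⟨j, Y⟩, z, hz⟩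
    have hoff := fun hij : i ≠ j =>
      inner_fderiv_bending_single_skew hWo hWc hF hnd hT hij hy hz X Y
    simp only [P, t, fderiv_extrinsicProduct_single (differentiableAt_of_mem_pi hWo hF hy),
      fderiv_extrinsicProduct_single (differentiableAt_of_mem_pi hWo hF hz),
      inner_piLp_single_left, inner_piLp_single_right] at hoff ⊢
    obtain rfl | hij := eq_or_ne i j
    · simp
    · simpa [hij, hij.symm] using hoff hij
  obtain ⟨D, hD, hDP⟩ := exists_skew_linearMap_of_span_eq_top
    (span_fderiv_single_eq_top hWo hF ho (hnd o ho)) hskew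
  exact ⟨D, hD, fun y hy i X => hDP ⟨⟨i, X⟩, ⟨y, hy⟩⟩⟩

end

section

variable (hWo : ∀ i, IsOpen (W i)) {o : ∀ i, E i} (ho : o ∈ Set.univ.pi W)
  (hT : IsInfinitesimalBendingOn 𝓘(ℝ, ∀ i, E i) (extrinsicProduct F) T (Set.univ.pi W))

include hWo ho hT

theorem IsInfinitesimalBendingOn.apply_update (hF : ∀ i, ContDiffOn ℝ ∞ (F i) (W i)) (i : ι) :
    IsInfinitesimalBendingOn 𝓘(ℝ, E i) (F i) (fun z => T (Function.update o i z) i) (W i) := by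
  have hmem : ∀ z ∈ W i, Function.update o i z ∈ Set.univ.pi W := fun z hz =>
    (Set.update_mem_pi_iff_of_mem ho).2 fun _ => hz
  have hW : IsOpen (Set.univ.pi W) := isOpen_set_pi Set.finite_univ fun i _ => hWo i
  rw [isInfinitesimalBendingOn_iff_fderiv]
  refine ⟨?_, fun z hz X Y => ?_⟩
  · exact contDiff_piLp_apply (i := i) (p := 2) |>.comp_contDiffOn
      (hT.1.contDiffOn.comp (contDiff_update ∞ o i).contDiffOn hmem)
  · have hFz := differentiableAt_of_mem_pi hWo hF (hmem z hz)
    have hbend := (isInfinitesimalBendingOn_iff_fderiv.1 hT).2 _ (hmem z hz) (Pi.single i X)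
      (Pi.single i Y)
    rw [fderiv_extrinsicProduct_single hFz, fderiv_extrinsicProduct_single hFz,
      inner_piLp_single_left, inner_piLp_single_right, Function.update_self] at hbend
    rw [(hasFDerivAt_apply_update (hT.differentiableAt hW (hmem z hz))).fderiv]
    exact hbend

theorem IsInfinitesimalBendingOn.apply_eq_apply_update (hWc : ∀ i, Convex ℝ (W i))
    (hdiag : ∀ y ∈ Set.univ.pi W, ∀ i X, fderiv ℝ T y (Pi.single i X) =
      PiLp.single 2 i (fderiv ℝ T y (Pi.single i X) i))
    {y : ∀ i, E i} (hy : y ∈ Set.univ.pi W) (i : ι) :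
    T y i = T (Function.update o i (y i)) i := by
  have hW : IsOpen (Set.univ.pi W) := isOpen_set_pi Set.finite_univ fun i _ => hWo i
  have hderiv : ∀ w ∈ Set.univ.pi W, HasFDerivAt (fun y => T y i) _ w := fun w hw =>
    hasFDerivAt_piLp_apply (hT.differentiableAt hW hw) i
  refine eq_of_fderiv_sub_eq_zero (convex_pi fun i _ => hWc i)
    (fun w hw => (hderiv w hw).differentiableAt) hy
    ((Set.update_mem_pi_iff_of_mem ho).2 fun _ => hy i trivial) fun w hw => ?_
  rw [(hderiv w hw).fderiv, ← Finset.univ_sum_single (Function.update o i (y i) - y), map_sum]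
  refine Finset.sum_eq_zero fun j _ => ?_
  change fderiv ℝ T w (Pi.single j _) i = 0
  obtain rfl | hij := eq_or_ne i j
  · simp
  · rw [hdiag w hw, PiLp.single_eq_of_ne 2 hij]

end

theorem exists_bendings_of_nondegenerateAt
    [∀ i, FiniteDimensional ℝ (V i)] [Nontrivial (∀ i, E i)]
    (hWo : ∀ i, IsOpen (W i)) (hWc : ∀ i, Convex ℝ (W i))
    (hF : ∀ i, ContDiffOn ℝ ∞ (F i) (W i))
    (hnd : ∀ y ∈ Set.univ.pi W, NondegenerateAt (extrinsicProduct F) y)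
    (hT : IsInfinitesimalBendingOn 𝓘(ℝ, ∀ i, E i) (extrinsicProduct F) T (Set.univ.pi W))
    {o : ∀ i, E i} (ho : o ∈ Set.univ.pi W) :
    ∃ (τ : ∀ i, E i → V i) (D : PiLp 2 V →ₗ[ℝ] PiLp 2 V),
      (∀ i, IsInfinitesimalBendingOn 𝓘(ℝ, E i) (F i) (τ i) (W i)) ∧
      (∀ a b, inner ℝ (D a) b = -inner ℝ a (D b)) ∧
      ∀ y ∈ Set.univ.pi W,
        T y = ∑ i, PiLp.single 2 i (τ i (y i)) + D (extrinsicProduct F y) := by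
  obtain ⟨D, hD, hDF⟩ := exists_skew_apply_fderiv_single hWo hWc hF hnd hT ho
  have hW : IsOpen (Set.univ.pi W) := isOpen_set_pi Set.finite_univ fun i _ => hWo i
  have hP := contDiffOn_extrinsicProduct hF
  set R := fun y => T y - D.toContinuousLinearMap (extrinsicProduct F y)
  have hRbend : IsInfinitesimalBendingOn _ _ R _ := hT.sub_skew hW hP hD
  have hdiag : ∀ y ∈ Set.univ.pi W, ∀ i X, fderiv ℝ R y (Pi.single i X) =
      PiLp.single 2 i (fderiv ℝ R y (Pi.single i X) i) := fun y hy i X => by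
    have hRX : fderiv ℝ R y (Pi.single i X) =
        PiLp.single 2 i (fderiv ℝ T y (Pi.single i X) i) := by
      rw [(hT.hasFDerivAt_sub_comp hW hP _ hy).fderiv]
      simp [hDF y hy]
    rw [hRX, PiLp.single_eq_same]
  refine ⟨fun i z => R (Function.update o i z) i, D, hRbend.apply_update hWo ho hF, hD,
    fun y hy => ?_⟩
  have hRy : R y = ∑ i, PiLp.single 2 i (R (Function.update o i (y i)) i) := by
    refine PiLp.ext fun i => ?_
    rw [hRbend.apply_eq_apply_update hWo ho hWc hdiag hy]
    simp [Finset.sum_apply]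
  exact sub_eq_iff_eq_add.1 hRy

end Box

section ProductManifold

variable {ι : Type*} [Fintype ι]
  {E : ι → Type*} [∀ i, NormedAddCommGroup (E i)] [∀ i, NormedSpace ℝ (E i)]
  {H : ι → Type*} [∀ i, TopologicalSpace (H i)] {I : ∀ i, ModelWithCorners ℝ (E i) (H i)}
  {M : ι → Type*} [∀ i, TopologicalSpace (M i)] [∀ i, ChartedSpace (H i) (M i)]

theorem range_modelWithCorners_pi :
    Set.range (ModelWithCorners.pi I) = Set.univ.pi fun i => Set.range (I i) :=
  Set.range_piMap fun i => I i

instance boundaryless_modelWithCorners_pi [∀ i, (I i).Boundaryless] :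
    (ModelWithCorners.pi I).Boundaryless where
  range_eq_univ := by simp [range_modelWithCorners_pi, (I _).range_eq_univ]

theorem extChartAt_pi_target (x : ∀ i, M i) :
    (extChartAt (ModelWithCorners.pi I) x).target =
      Set.univ.pi fun i => (extChartAt (I i) (x i)).target := by
  ext y
  simp only [extChartAt, OpenPartialHomeomorph.extend_target, range_modelWithCorners_pi]
  exact ⟨fun h i hi => ⟨h.1 i hi, h.2 i hi⟩,
    fun h => ⟨fun i hi => (h i hi).1, fun i hi => (h i hi).2⟩⟩

instance isManifold_modelWithCorners_pi {n : ℕ∞ω} [∀ i, IsManifold (I i) n (M i)] :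
    IsManifold (ModelWithCorners.pi I) n (∀ i, M i) := by
  refine isManifold_of_contDiffOn _ _ _ ?_
  rintro _ _ ⟨e, he, rfl⟩ ⟨e', he', rfl⟩
  refine contDiffOn_pi.2 fun i => ?_
  have hi : ContDiffOn ℝ n (I i ∘ (e i).symm ≫ₕ e' i ∘ (I i).symm)
      ((I i).symm ⁻¹' ((e i).symm ≫ₕ e' i).source ∩ Set.range (I i)) :=
    ((contDiffGroupoid n (I i)).compatible (he i trivial) (he' i trivial)).1
  refine hi.comp (contDiff_pi.1 contDiff_id i).contDiffOn ?_
  rintro y ⟨⟨hye, hye'⟩, hyI⟩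
  rw [range_modelWithCorners_pi] at hyI
  exact ⟨⟨hye i trivial, hye' i trivial⟩, hyI i trivial⟩

theorem contMDiff_eval {n : ℕ∞ω} (i : ι) :
    ContMDiff (ModelWithCorners.pi I) (I i) n (fun x : ∀ i, M i => x i) := fun x =>
  contMDiffAt_iff_target.2 ⟨(continuous_apply i).continuousAt,
    contMDiffAt_pi_space.1 (contMDiffAt_extChartAt (I := ModelWithCorners.pi I) (x := x)) i⟩

variable {V : ι → Type*} [∀ i, NormedAddCommGroup (V i)] [∀ i, InnerProductSpace ℝ (V i)]
  {f : ∀ i, M i → V i}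

theorem contMDiff_extrinsicProduct (hf : ∀ i, ContMDiff (I i) 𝓘(ℝ, V i) ∞ (f i)) :
    ContMDiff (ModelWithCorners.pi I) 𝓘(ℝ, PiLp 2 V) ∞ (extrinsicProduct f) :=
  (PiLp.continuousLinearEquiv 2 ℝ V).symm.contDiff.contMDiff.comp <|
    contMDiff_pi_space.2 fun i => (hf i).comp (contMDiff_eval i)

end ProductManifold

section Charts

variable {E : Type*} [NormedAddCommGroup E] [NormedSpace ℝ E]
  {H : Type*} [TopologicalSpace H] {I : ModelWithCorners ℝ E H}
  {M : Type*} [TopologicalSpace M] [ChartedSpace H M]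
  {V : Type*} [NormedAddCommGroup V] [InnerProductSpace ℝ V] {f : M → V}

theorem IsInfinitesimalBendingOn.mono {T : M → V} {U U' : Set M}
    (hT : IsInfinitesimalBendingOn I f T U) (hU : U' ⊆ U) : IsInfinitesimalBendingOn I f T U' :=
  ⟨hT.1.mono hU, fun x hx => hT.2 x (hU hx)⟩

theorem IsInfinitesimalBendingOn.comp {T : M → V} {U : Set M}
    {E' : Type*} [NormedAddCommGroup E'] [NormedSpace ℝ E'] {H' : Type*} [TopologicalSpace H']
    {J : ModelWithCorners ℝ E' H'} {N : Type*} [TopologicalSpace N] [ChartedSpace H' N]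
    {U' : Set N} {ψ : N → M} {h : N → V}
    (hT : IsInfinitesimalBendingOn I f T U) (hU : IsOpen U)
    (hf : ∀ x ∈ U, MDifferentiableAt I 𝓘(ℝ, V) f x)
    (hU' : IsOpen U') (hψ : ContMDiffOn J I ∞ ψ U') (hmaps : Set.MapsTo ψ U' U)
    (hh : Set.EqOn h (f ∘ ψ) U') :
    IsInfinitesimalBendingOn J h (T ∘ ψ) U' := by
  refine ⟨hT.1.comp hψ hmaps, fun x hx X Y => ?_⟩
  have hψx : MDifferentiableAt J I ψ x :=
    (hψ.contMDiffAt (hU'.mem_nhds hx)).mdifferentiableAt (by simp)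
  have hTx : MDifferentiableAt I 𝓘(ℝ, V) T (ψ x) :=
    (hT.1.contMDiffAt (hU.mem_nhds (hmaps hx))).mdifferentiableAt (by simp)
  have hchain {G : M → V} (hG : MDifferentiableAt I 𝓘(ℝ, V) G (ψ x)) (X : TangentSpace J x) :
      differential J (G ∘ ψ) x X = differential I G (ψ x) (mfderiv J I ψ x X) := by
    rw [differential, mfderiv_comp x hG hψx]
    rfl
  have hhx (X : TangentSpace J x) : differential J h x X = differential J (f ∘ ψ) x X := by
    rw [differential, (hh.eventuallyEq_of_mem (hU'.mem_nhds hx)).mfderiv_eq]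
    rfl
  rw [hhx, hhx, hchain hTx, hchain hTx, hchain (hf _ (hmaps hx)), hchain (hf _ (hmaps hx))]
  exact hT.2 _ (hmaps hx) _ _

theorem differential_eq_fderiv [I.Boundaryless] {x : M} (hf : MDifferentiableAt I 𝓘(ℝ, V) f x) :
    differential I f x = fderiv ℝ (f ∘ (extChartAt I x).symm) (extChartAt I x x) := by
  rw [differential, hf.mfderiv, I.range_eq_univ, fderivWithin_univ]
  rfl

theorem chartHessian_apply [I.Boundaryless] (f : M → V) (x : M) (X Y : TangentSpace I x) :
    chartHessian I f x X Y =
      fderiv ℝ (fderiv ℝ (f ∘ (extChartAt I x).symm)) (extChartAt I x x) X Y := by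
  simp only [chartHessian, I.range_eq_univ, fderivWithin_univ]
  rfl

variable [IsManifold I ∞ M]

theorem contDiffOn_comp_extChartAt_symm (hf : ContMDiff I 𝓘(ℝ, V) ∞ f) (x : M) :
    ContDiffOn ℝ ∞ (f ∘ (extChartAt I x).symm) (extChartAt I x).target :=
  contMDiffOn_iff_contDiffOn.1 (hf.comp_contMDiffOn (contMDiffOn_extChartAt_symm x))

theorem IsInfinitesimalBendingOn.comp_extChartAt_symm [I.Boundaryless] {T : M → V}
    (hf : ContMDiff I 𝓘(ℝ, V) ∞ f) (hT : IsInfinitesimalBending I f T) (x : M) :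
    IsInfinitesimalBendingOn 𝓘(ℝ, E) (f ∘ (extChartAt I x).symm) (T ∘ (extChartAt I x).symm)
      (extChartAt I x).target :=
  hT.comp isOpen_univ (fun _ _ => hf.mdifferentiableAt (by simp)) (isOpen_extChartAt_target x)
    (contMDiffOn_extChartAt_symm x) (Set.mapsTo_univ _ _) (Set.eqOn_refl _ _)

theorem IsInfinitesimalBendingOn.comp_extChartAt {x : M} {τ : E → V}
    {W : Set E} (hτ : IsInfinitesimalBendingOn 𝓘(ℝ, E) (f ∘ (extChartAt I x).symm) τ W)
    (hf : ContMDiff I 𝓘(ℝ, V) ∞ f) (hW : IsOpen W) (hWt : W ⊆ (extChartAt I x).target) :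
    IsInfinitesimalBendingOn I f (τ ∘ extChartAt I x)
      ((extChartAt I x).source ∩ extChartAt I x ⁻¹' W) := by
  refine hτ.comp hW (fun y hy => ?_) (isOpen_extChartAt_preimage' x hW)
    (contMDiffOn_extChartAt.mono ?_) (fun z hz => hz.2) fun z hz => ?_
  · exact ((contDiffOn_comp_extChartAt_symm hf x).contDiffAt
      (Filter.mem_of_superset (hW.mem_nhds hy) hWt)).differentiableAt (by simp) |>.mdifferentiableAt
  · exact extChartAt_source I x ▸ Set.inter_subset_left
  · simp only [Function.comp_apply, (extChartAt I x).left_inv hz.1]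

theorem surjective_fderiv_extChartAt_comp_symm [I.Boundaryless] {x₀ x : M}
    (hx : x ∈ (extChartAt I x₀).source) :
    Function.Surjective
      (fderiv ℝ (extChartAt I x₀ ∘ (extChartAt I x).symm) (extChartAt I x x)) := by
  have : IsManifold I 1 M := .of_le (n := ∞) (by simp)
  have hxx : x ∈ (extChartAt I x).source := mem_extChartAt_source x
  rw [← fderivWithin_univ, ← I.range_eq_univ]
  exact fun v => ⟨tangentCoordChange I x₀ x x v,
    (tangentCoordChange_comp ⟨⟨hx, hxx⟩, hx⟩).trans (tangentCoordChange_self hx)⟩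

theorem nondegenerateAt_comp_extChartAt_symm [I.Boundaryless]
    (hf : ContMDiff I 𝓘(ℝ, V) ∞ f) {x₀ x : M} (hx : x ∈ (extChartAt I x₀).source)
    (hnd : NondegenerateAt (f ∘ (extChartAt I x).symm) (extChartAt I x x)) :
    NondegenerateAt (f ∘ (extChartAt I x₀).symm) (extChartAt I x₀ x) := by
  have hx' : (extChartAt I x).symm (extChartAt I x x) = x := extChartAt_to_inv x
  have hψ : (extChartAt I x₀ ∘ (extChartAt I x).symm) (extChartAt I x x) = extChartAt I x₀ x := by
    rw [Function.comp_apply, hx']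
  have htwo : (2 : ℕ∞ω) ≤ ∞ := WithTop.coe_le_coe.2 le_top
  rw [← hψ]
  refine hnd.of_comp (.of_le ?_ htwo) (.of_le ?_ htwo) ?_
    (surjective_fderiv_extChartAt_comp_symm hx)
  · rw [hψ]
    exact (contDiffOn_comp_extChartAt_symm hf x₀).contDiffAt
      ((isOpen_extChartAt_target x₀).mem_nhds ((extChartAt I x₀).map_source hx))
  · rw [← contDiffWithinAt_univ, ← I.range_eq_univ]
    exact contDiffWithinAt_ext_coord_change x₀ x (by simpa using hx)
  · have hsource : ∀ᶠ z in nhds (extChartAt I x x),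
        (extChartAt I x).symm z ∈ (extChartAt I x₀).source :=
      (continuousAt_extChartAt_symm x).eventually <|
        hx'.symm ▸ (isOpen_extChartAt_source x₀).mem_nhds hx
    filter_upwards [hsource] with z hz
    simp only [Function.comp_apply, (extChartAt I x₀).left_inv hz]

end Charts

section Nullity

variable {E : Type*} [NormedAddCommGroup E] [NormedSpace ℝ E]
  {H : Type*} [TopologicalSpace H] {I : ModelWithCorners ℝ E H}
  {M : Type*} [TopologicalSpace M] [ChartedSpace H M]
  {V : Type*} [NormedAddCommGroup V] [InnerProductSpace ℝ V] [FiniteDimensional ℝ V]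
  {f : M → V} {x : M} {U : Submodule ℝ V}

theorem mem_nullitySpace_of_inner_chartHessian_eq_zero (hU : U ≤ normalSpace I f x)
    {Y : TangentSpace I x} (hY : ∀ X, ∀ u ∈ U, inner ℝ (chartHessian I f x Y X) u = 0) :
    Y ∈ nullitySpace I f x U := by
  intro X
  rw [Submodule.starProjection_apply_eq_zero_iff, Submodule.mem_orthogonal']
  intro u hu
  change inner ℝ ((normalSpace I f x).starProjection (chartHessian I f x Y X)) u = 0
  rw [Submodule.inner_starProjection_left_eq_right,
    Submodule.starProjection_eq_self_iff.2 (hU hu)]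
  exact hY X u hu

theorem finrank_add_finrank_normalSpace (hinj : Function.Injective (differential I f x)) :
    Module.finrank ℝ E + Module.finrank ℝ (normalSpace I f x) = Module.finrank ℝ V := by
  rw [← Submodule.finrank_add_finrank_orthogonal (differential I f x).range]
  exact congrArg (· + _) (LinearMap.finrank_range_of_inj hinj).symm

variable [FiniteDimensional ℝ E]

instance finiteDimensional_tangentSpace : FiniteDimensional ℝ (TangentSpace I x) :=
  inferInstanceAs (FiniteDimensional ℝ E)

theorem finrank_le_sNullity (hU : U ≤ normalSpace I f x) {K : Submodule ℝ (TangentSpace I x)}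
    (hK : K ≤ nullitySpace I f x U) :
    Module.finrank ℝ K ≤ sNullity I f x (Module.finrank ℝ U) := by
  refine (Submodule.finrank_mono hK).trans
    (le_csSup ⟨Module.finrank ℝ (TangentSpace I x), ?_⟩ ⟨U, hU, rfl, rfl⟩)
  rintro d ⟨U', -, -, rfl⟩
  exact Submodule.finrank_le _

theorem nondegenerateAt_of_sNullity_lt [I.Boundaryless] (hf : MDifferentiableAt I 𝓘(ℝ, V) f x)
    (hinj : Function.Injective (differential I f x))
    (hν : ∀ s, 1 ≤ s → Module.finrank ℝ E + s ≤ Module.finrank ℝ V →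
      sNullity I f x s + s < Module.finrank ℝ E) :
    NondegenerateAt (f ∘ (extChartAt I x).symm) (extChartAt I x x) := by
  intro B hB hB'
  have hU : LinearMap.range B ≤ normalSpace I f x := by
    rintro _ ⟨Z, rfl⟩
    refine (Submodule.mem_orthogonal _ _).2 ?_
    rintro _ ⟨X, rfl⟩
    refine (congrArg (inner ℝ · (B Z)) ?_).trans (hB X Z)
    exact DFunLike.congr_fun (differential_eq_fderiv hf) X
  have hK : LinearMap.ker B ≤ nullitySpace I f x (LinearMap.range B) := by
    refine fun Y hY => mem_nullitySpace_of_inner_chartHessian_eq_zero hU ?_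
    rintro X _ ⟨Z, rfl⟩
    refine (congrArg (inner ℝ · (B Z)) (chartHessian_apply f x Y X)).trans <|
      (hB' Y X Z).trans ?_
    rw [LinearMap.mem_ker.1 hY, inner_zero_right]
  by_contra hB0
  have hrange : 1 ≤ Module.finrank ℝ (LinearMap.range B) := Submodule.one_le_finrank_iff.2 <|
    LinearMap.range_eq_bot.not.2 hB0
  have hnormal := finrank_add_finrank_normalSpace hinj
  have hlt := hν _ hrange (by linarith [Submodule.finrank_mono hU])
  have hle : Module.finrank ℝ (LinearMap.ker B) ≤ _ := finrank_le_sNullity hU hK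
  have hrank := LinearMap.finrank_range_add_finrank_ker B
  omega

theorem nondegenerateAt_of_mem_extChartAt_target [I.Boundaryless] [IsManifold I ∞ M]
    (hf : ContMDiff I 𝓘(ℝ, V) ∞ f) (hinj : ∀ x, Function.Injective (differential I f x))
    (hν : ∀ x s, 1 ≤ s → Module.finrank ℝ E + s ≤ Module.finrank ℝ V →
      sNullity I f x s + s < Module.finrank ℝ E)
    {y : E} (hy : y ∈ (extChartAt I x).target) :
    NondegenerateAt (f ∘ (extChartAt I x).symm) y := by
  have hnd := nondegenerateAt_comp_extChartAt_symm hf ((extChartAt I x).map_target hy)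
    (nondegenerateAt_of_sNullity_lt (hf.mdifferentiableAt (by simp)) (hinj _) (hν _))
  rwa [(extChartAt I x).right_inv hy] at hnd

end Nullity

section InjectiveDifferential

theorem IsIsometricImmersion.differential_injective {E : Type*} [NormedAddCommGroup E]
    [NormedSpace ℝ E] {H : Type*} [TopologicalSpace H] {I : ModelWithCorners ℝ E H}
    {M : Type*} [TopologicalSpace M] [ChartedSpace H M] [IsManifold I 1 M]
    {V : Type*} [NormedAddCommGroup V] [InnerProductSpace ℝ V]
    {g : Bundle.ContMDiffRiemannianMetric I ∞ E (fun x : M => TangentSpace I x)} {f : M → V}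
    (hf : IsIsometricImmersion I g f) (x : M) : Function.Injective (differential I f x) := by
  refine (injective_iff_map_eq_zero _).2 fun X hX => by_contra fun hX0 => ?_
  have hpos := g.pos x X hX0
  rw [← hf.2, hX, inner_zero_left] at hpos
  exact hpos.false

variable {ι : Type*} [Fintype ι]
  {E : ι → Type*} [∀ i, NormedAddCommGroup (E i)] [∀ i, NormedSpace ℝ (E i)]
  {H : ι → Type*} [∀ i, TopologicalSpace (H i)] {I : ∀ i, ModelWithCorners ℝ (E i) (H i)}
  [∀ i, (I i).Boundaryless]
  {M : ι → Type*} [∀ i, TopologicalSpace (M i)] [∀ i, ChartedSpace (H i) (M i)]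
  [∀ i, IsManifold (I i) ∞ (M i)]
  {V : ι → Type*} [∀ i, NormedAddCommGroup (V i)] [∀ i, InnerProductSpace ℝ (V i)]
  {f : ∀ i, M i → V i}

theorem differential_extrinsicProduct_apply (hf : ∀ i, ContMDiff (I i) 𝓘(ℝ, V i) ∞ (f i))
    (x : ∀ i, M i) (X : TangentSpace (ModelWithCorners.pi I) x) (i : ι) :
    differential (ModelWithCorners.pi I) (extrinsicProduct f) x X i =
      differential (I i) (f i) (x i) (X i) := by
  rw [differential_eq_fderiv ((contMDiff_extrinsicProduct hf).mdifferentiableAt (by simp)),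
    differential_eq_fderiv ((hf i).mdifferentiableAt (by simp))]
  have hF (i : ι) : DifferentiableAt ℝ (f i ∘ (extChartAt (I i) (x i)).symm)
      (extChartAt (I i) (x i) (x i)) :=
    ((contDiffOn_comp_extChartAt_symm (hf i) (x i)).contDiffAt
      (extChartAt_target_mem_nhds (x i))).differentiableAt (by simp)
  exact congrArg (fun L => L X i) (hasFDerivAt_extrinsicProduct hF).fderiv

theorem injective_differential_extrinsicProduct
    (hf : ∀ i, ContMDiff (I i) 𝓘(ℝ, V i) ∞ (f i)) {x : ∀ i, M i}
    (hinj : ∀ i, Function.Injective (differential (I i) (f i) (x i))) :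
    Function.Injective (differential (ModelWithCorners.pi I) (extrinsicProduct f) x) :=
  fun X Y hXY => funext fun i => hinj i <| by
    rw [← differential_extrinsicProduct_apply hf, hXY, differential_extrinsicProduct_apply hf]

end InjectiveDifferential

section Dimension

variable {ι : Type*} [Fintype ι] (n : ι → ℕ)

theorem finrank_pi_euclideanSpace :
    Module.finrank ℝ (∀ i, EuclideanSpace ℝ (Fin (n i))) = ∑ i, n i := by
  simp [Module.finrank_pi_fintype]

theorem finrank_piLp_euclideanSpace :
    Module.finrank ℝ (PiLp 2 fun i => EuclideanSpace ℝ (Fin (n i))) = ∑ i, n i := by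
  rw [(WithLp.linearEquiv 2 ℝ (∀ i, EuclideanSpace ℝ (Fin (n i)))).finrank_eq,
    finrank_pi_euclideanSpace]

end Dimension

end InfinitesimalBending

open InfinitesimalBending in
theorem mainTheorem4_general {ι : Type*} [Fintype ι] [DecidableEq ι]
    {E : ι → Type*} [∀ i, NormedAddCommGroup (E i)] [∀ i, NormedSpace ℝ (E i)]
    [∀ i, FiniteDimensional ℝ (E i)] [Nontrivial (∀ i, E i)]
    {H : ι → Type*} [∀ i, TopologicalSpace (H i)] {I : ∀ i, ModelWithCorners ℝ (E i) (H i)}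
    [∀ i, (I i).Boundaryless]
    {M : ι → Type*} [∀ i, TopologicalSpace (M i)] [∀ i, ChartedSpace (H i) (M i)]
    [∀ i, IsManifold (I i) ∞ (M i)]
    {V : ι → Type*} [∀ i, NormedAddCommGroup (V i)] [∀ i, InnerProductSpace ℝ (V i)]
    [∀ i, FiniteDimensional ℝ (V i)]
    {f : ∀ i, M i → V i} (hf : ∀ i, ContMDiff (I i) 𝓘(ℝ, V i) ∞ (f i))
    (hinj : ∀ i x, Function.Injective (differential (I i) (f i) x))
    (hν : ∀ (x : ∀ i, M i) (s : ℕ), 1 ≤ s →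
      Module.finrank ℝ (∀ i, E i) + s ≤ Module.finrank ℝ (PiLp 2 V) →
      sNullity (ModelWithCorners.pi I) (extrinsicProduct f) x s + s <
        Module.finrank ℝ (∀ i, E i))
    {T : (∀ i, M i) → PiLp 2 V}
    (hT : IsInfinitesimalBending (ModelWithCorners.pi I) (extrinsicProduct f) T)
    (x₀ : ∀ i, M i) :
    ∃ (U : ∀ i, Set (M i)) (τ : ∀ i, M i → V i) (S : (∀ i, M i) → PiLp 2 V),
      (∀ i, IsOpen (U i) ∧ x₀ i ∈ U i) ∧
      (∀ i, IsInfinitesimalBendingOn (I i) (f i) (τ i) (U i)) ∧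
      IsTrivialBending (extrinsicProduct f) S ∧
      ∀ x : ∀ i, M i, (∀ i, x i ∈ U i) →
        T x = (∑ i, PiLp.single 2 i (τ i (x i))) + S x := by
  choose ε hε hεt using fun i =>
    Metric.mem_nhds_iff.1 (extChartAt_target_mem_nhds (I := I i) (x₀ i))
  set W := fun i => Metric.ball (extChartAt (I i) (x₀ i) (x₀ i)) (ε i)
  have hWo : ∀ i, IsOpen (W i) := fun i => Metric.isOpen_ball
  have hfp := contMDiff_extrinsicProduct hf
  have hWt : Set.univ.pi W ⊆ (extChartAt (ModelWithCorners.pi I) x₀).target :=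
    extChartAt_pi_target (I := I) x₀ ▸ Set.pi_mono fun i _ => hεt i
  obtain ⟨τ, D, hτ, hD, hTW⟩ := exists_bendings_of_nondegenerateAt hWo
    (fun i => convex_ball _ _)
    (fun i => (contDiffOn_comp_extChartAt_symm (hf i) (x₀ i)).mono (hεt i))
    (fun y hy => nondegenerateAt_of_mem_extChartAt_target hfp
      (fun x => injective_differential_extrinsicProduct hf fun i => hinj i (x i)) hν (hWt hy))
    ((IsInfinitesimalBendingOn.comp_extChartAt_symm hfp hT x₀).mono hWt)
    fun i _ => Metric.mem_ball_self (hε i)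
  refine ⟨fun i => (extChartAt (I i) (x₀ i)).source ∩ extChartAt (I i) (x₀ i) ⁻¹' W i,
    fun i => τ i ∘ extChartAt (I i) (x₀ i), D ∘ extrinsicProduct f,
    fun i => ⟨isOpen_extChartAt_preimage' (x₀ i) (hWo i), mem_extChartAt_source (x₀ i),
      Metric.mem_ball_self (hε i)⟩,
    fun i => (hτ i).comp_extChartAt (hf i) (hWo i) (hεt i),
    ⟨D, 0, hD, fun x => (add_zero _).symm⟩, fun x hx => ?_⟩
  set y := fun i => extChartAt (I i) (x₀ i) (x i)
  have hxy : (extChartAt (ModelWithCorners.pi I) x₀).symm y = x :=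
    funext fun i => (extChartAt (I i) (x₀ i)).left_inv (hx i).1
  have hfxy : extrinsicProduct (fun i => f i ∘ (extChartAt (I i) (x₀ i)).symm) y =
      extrinsicProduct f x := congrArg (extrinsicProduct f) hxy
  have hTy := hTW y fun i _ => (hx i).2
  rwa [Function.comp_apply, hxy, hfxy] at hTy

theorem mainTheorem4 {r : ℕ} (n p : Fin r → ℕ)
    (M : Fin r → Type*) [∀ i, TopologicalSpace (M i)]
    [∀ i, ChartedSpace (EuclideanSpace ℝ (Fin (n i))) (M i)]
    [∀ i, IsManifold (𝓡 (n i)) ∞ (M i)]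
    (g : ∀ i, Bundle.ContMDiffRiemannianMetric (𝓡 (n i)) ∞ (EuclideanSpace ℝ (Fin (n i)))
      (fun x : M i => TangentSpace (𝓡 (n i)) x))
    (f : ∀ i, M i → EuclideanSpace ℝ (Fin (n i + p i)))
    (hf : ∀ i, InfinitesimalBending.IsIsometricImmersion (𝓡 (n i)) (g i) (f i))
    (hn : ∀ i, 2 ≤ n i)
    (hpn : ∑ i, p i < ∑ i, n i)
    (hν : ∀ (x : ∀ i, M i) (s : ℕ), 1 ≤ s → s ≤ ∑ i, p i →
      InfinitesimalBending.sNullity (ModelWithCorners.pi fun i => 𝓡 (n i))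
        (InfinitesimalBending.extrinsicProduct f) x s < (∑ i, n i) - s)
    (T : (∀ i, M i) → PiLp 2 fun i => EuclideanSpace ℝ (Fin (n i + p i)))
    (hT : InfinitesimalBending.IsInfinitesimalBending (ModelWithCorners.pi fun i => 𝓡 (n i))
      (InfinitesimalBending.extrinsicProduct f) T)
    (x₀ : ∀ i, M i) :
    ∃ (U : ∀ i, Set (M i)) (τ : ∀ i, M i → EuclideanSpace ℝ (Fin (n i + p i)))
      (S : (∀ i, M i) → PiLp 2 fun i => EuclideanSpace ℝ (Fin (n i + p i))),
      (∀ i, IsOpen (U i) ∧ x₀ i ∈ U i) ∧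
      (∀ i, InfinitesimalBending.IsInfinitesimalBendingOn (𝓡 (n i)) (f i) (τ i) (U i)) ∧
      InfinitesimalBending.IsTrivialBending (InfinitesimalBending.extrinsicProduct f) S ∧
      ∀ x : ∀ i, M i, (∀ i, x i ∈ U i) →
        T x = (∑ i, PiLp.single 2 i (τ i (x i))) + S x := by
  have hE := InfinitesimalBending.finrank_pi_euclideanSpace n
  have hV := InfinitesimalBending.finrank_piLp_euclideanSpace fun i => n i + p i
  rw [Finset.sum_add_distrib] at hV
  have : Nontrivial (∀ i, EuclideanSpace ℝ (Fin (n i))) :=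
    Module.nontrivial_of_finrank_pos (R := ℝ) (by omega)
  refine mainTheorem4_general (fun i => (hf i).1) (fun i => (hf i).differential_injective)
    (fun x s hs hsp => ?_) hT x₀
  have hνs := hν x s hs (by omega)
  omega
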